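/- Let $n\ge 1$, $0<s_0<s<1$, $0<\lambda\le\Lambda$. For $u:\mathbb{R}^n\to\mathbb{R}$ put $\delta u(x,y)=u(x+y)+u(x-y)-2u(x)$, and write $u\in C^{1,1}(x)$ if there are quadratic polynomials $P,Q$ with $P(x)=u(x)=Q(x)$ and $P\le u\le Q$ near $x$. Let $\mathcal{L}_0$ be the class of linear operators $Lu(x)=\int_{\mathbb{R}^n}\delta u(x,y)\,a(y)\,dy$ whose measurable kernels satisfy $a(-y)=a(y)$ and $(1-s)\frac{\lambda}{|y|^{n+2s}}\le a(y)\le(1-s)\frac{\Lambda}{|y|^{n+2s}}$ for $y\neq 0$, and set $M^-u(x)=\inf_{L\in\mathcal{L}_0}Lu(x)$, $M^+u(x)=\sup_{L\in\mathcal{L}_0}Lu(x)$. Let $I$ be a nonlocal operator: $Iu(x)\in\mathbb{R}$ is defined for bounded measurable $u\in C^{1,1}(x)$, and $Iu$ is continuous on every open set on which $u$ is $C^2$. Assume that $I$ is translation invariant, that $I(0)=0$, and that $I$ is uniformly elliptic with respect to $\mathcal{L}_0$, i.e. $M^-(u-v)(x)\le Iu(x)-Iv(x)\le M^+(u-v)(x)$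 for all bounded measurable $u,v\in C^{1,1}(x)$. Let $K\subset\mathbb{R}^n$ be a compact convex set whose interior contains the origin. Let $\gamma(x)=\inf\{t>0: x\in tK\}$ be its gauge, and let $\gamma^\circ$ be the gauge of the polar $K^\circ=\{x:\langle x,y\rangle\le1 \text{ for all } y\in K\}$. Let $U\subset\mathbb{R}^n$ be a bounded open set, and let $\varphi:\mathbb{R}^n\to\mathbb{R}$ be bounded, convex on a neighborhood of $\partial U$, and such that $-\gamma(y-x)\le\varphi(x)-\varphi(y)\le\gamma(x-y)$ for all $x,y\in\mathbb{R}^n$. Define $\rho(x)=\min_{y\in\partial U}[\gamma(x-y)+\varphi(y)]$ and $\bar\rho(x)=\min_{y\in\partial U}[\gamma(y-x)-\varphi(y)]$ for $x\in U$, and $\rho=-\bar\rho=\varphi$ on $\mathbb{R}^n-U$. An equation is of the form $F(x,u(x),Du(x),u(\cdot))=0$. An upper semicontinuous $u:\mathbb{R}^n\to\mathbb{R}$ satisfies $F\le0$ in the viscosity sense in $U$ if, whenever $\phi$ is a bounded $C^2$ function on $\mathbb{R}^n$ and $u-\phi$ has a maximum over $\mathbb{R}^n$ at $x_0\in U$,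 then $F(x_0,u(x_0),D\phi(x_0),\phi(\cdot))\le0$. A lower semicontinuous $u$ satisfies $F\ge0$ in the viscosity sense in $U$ if the reverse inequality holds whenever $u-\phi$ has a minimum over $\mathbb{R}^n$ at $x_0\in U$. A viscosity solution of $F=0$ in $U$ is a continuous $u:\mathbb{R}^n\to\mathbb{R}$ with both properties. Suppose that there is a bounded continuous function $v:\mathbb{R}^n\to\mathbb{R}$ with $-\bar\rho\le v\le\rho$ that satisfies $-Iv\le0$ in the viscosity sense in $U$. Let $u\in C^1(U)$ be a viscosity solution of the double obstacle problem \[ \max\{\min\{-Iu,\;u+\bar\rho\},\;u-\rho\}=0\ \text{ in } U,\qquad u=\varphi\ \text{ in }\mathbb{R}^n-U. \] Then $u$ is also a viscosity solution of the equation with gradient constraint \[ \max\{-Iu,\;\gamma^\circ(Du)-1\}=0\ \text{ in } U,\qquad u=\varphi\ \text{ in }\mathbb{R}^n-U. \] -/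

import Mathlib

open Set Filter Topology MeasureTheory

noncomputable section

namespace NonlocalGradient

/-- The Euclidean space `ℝⁿ`. -/
abbrev Rn (n : ℕ) : Type := EuclideanSpace ℝ (Fin n)

/-! ### Nonlocal operators -/

/-- Bounded real functions on `ℝⁿ`. -/
def IsBdd {n : ℕ} (u : Rn n → ℝ) : Prop := ∃ C : ℝ, ∀ x, |u x| ≤ C

/-- The second difference `δu(x,y) = u(x+y) + u(x-y) - 2u(x)`. -/
def secondDiff {n : ℕ} (u : Rn n → ℝ) (x y : Rn n) : ℝ :=
  u (x + y) + u (x - y) - 2 * u x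

/-- `u ∈ C^{1,1}(x)`: there are quadratic polynomials `P`, `Q` (written in powers of `z - x`)
with `P(x) = u(x) = Q(x)` and `P ≤ u ≤ Q` near `x`. -/
def IsC11At {n : ℕ} (u : Rn n → ℝ) (x : Rn n) : Prop :=
  ∃ (p q : Rn n) (A B : Rn n →L[ℝ] Rn n), ∀ᶠ z in 𝓝 x,
    u x + inner ℝ p (z - x) + inner ℝ (A (z - x)) (z - x) ≤ u z ∧
    u z ≤ u x + inner ℝ q (z - x) + inner ℝ (B (z - x)) (z - x)

/-- The functions `u` for which a nonlocal operator can be evaluated at the point `x`: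
bounded (Borel) functions which are `C^{1,1}` at `x`. -/
def AdmissibleAt {n : ℕ} (u : Rn n → ℝ) (x : Rn n) : Prop :=
  Measurable u ∧ IsBdd u ∧ IsC11At u x

/-- Kernels of linear nonlocal operators. The value at the origin is irrelevant. -/
structure IsKernel {n : ℕ} (a : Rn n → ℝ) : Prop where
  measurable : Measurable a
  pos : ∀ y, y ≠ 0 → 0 < a y
  symm : ∀ y, a (-y) = a y
  integrable : Integrable (fun y => min 1 (‖y‖ ^ 2) * a y)

/-- The linear nonlocal operator with kernel `a`: `Lu(x) = ∫ δu(x,y) a(y) dy`. -/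
def linearOp {n : ℕ} (a : Rn n → ℝ) (u : Rn n → ℝ) (x : Rn n) : ℝ :=
  ∫ y, secondDiff u x y * a y

/-- The extremal operator `M⁻u(x) = inf Lu(x)` over a family `𝓛` of linear operators, which are
represented by their kernels. -/
def extremalInf {n : ℕ} (𝓛 : Set (Rn n → ℝ)) (u : Rn n → ℝ) (x : Rn n) : ℝ :=
  sInf ((fun a => linearOp a u x) '' 𝓛)

/-- The extremal operator `M⁺u(x) = sup Lu(x)`. -/
def extremalSup {n : ℕ} (𝓛 : Set (Rn n → ℝ)) (u : Rn n → ℝ) (x : Rn n) : ℝ :=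
  sSup ((fun a => linearOp a u x) '' 𝓛)

/-- The class `𝓛₀` of kernels comparable with the kernel of `-(-Δ)^s`, with ellipticity constants
`lam ≤ Lam`. -/
def classL0 (n : ℕ) (s lam Lam : ℝ) : Set (Rn n → ℝ) :=
  {a | IsKernel a ∧ ∀ y, y ≠ 0 →
    (1 - s) * (lam / ‖y‖ ^ ((n : ℝ) + 2 * s)) ≤ a y ∧
    a y ≤ (1 - s) * (Lam / ‖y‖ ^ ((n : ℝ) + 2 * s))}

/-- `I` is a nonlocal operator: `I u x` is meaningful when `AdmissibleAt u x` holds (other values of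
`I` are never constrained), and `Iu` is continuous on open sets on which `u` is `C²`. -/
def IsNonlocalOp {n : ℕ} (I : (Rn n → ℝ) → Rn n → ℝ) : Prop :=
  ∀ (u : Rn n → ℝ) (V : Set (Rn n)), Measurable u → IsBdd u → IsOpen V →
    ContDiffOn ℝ 2 u V → ContinuousOn (I u) V

/-- `I` is uniformly elliptic with respect to the family `𝓛`. -/
def IsUniformlyElliptic {n : ℕ} (𝓛 : Set (Rn n → ℝ)) (I : (Rn n → ℝ) → Rn n → ℝ) : Prop :=
  ∀ (u v : Rn n → ℝ) (x : Rn n), AdmissibleAt u x → AdmissibleAt v x →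
    extremalInf 𝓛 (u - v) x ≤ I u x - I v x ∧ I u x - I v x ≤ extremalSup 𝓛 (u - v) x

/-- `I(τ_z u) = τ_z (Iu)`, where `τ_z u(x) = u(x - z)`, wherever `Iu` is meaningful. -/
def IsTranslationInvariant {n : ℕ} (I : (Rn n → ℝ) → Rn n → ℝ) : Prop :=
  ∀ (u : Rn n → ℝ) (z x : Rn n), AdmissibleAt u (x - z) →
    I (fun y => u (y - z)) x = I u (x - z)

/-! ### Convex sets and obstacles -/

/-- The polar `K° = {x : ⟨x,y⟩ ≤ 1 for all y ∈ K}`. -/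
def polarSet {n : ℕ} (K : Set (Rn n)) : Set (Rn n) :=
  {x | ∀ y ∈ K, inner ℝ x y ≤ 1}

/-- The upper obstacle `ρ`, extended by `φ` outside `U`. -/
def rho {n : ℕ} (K U : Set (Rn n)) (φ : Rn n → ℝ) (x : Rn n) : ℝ :=
  open Classical in
  if x ∈ U then ⨅ y : frontier U, (gauge K (x - y) + φ y) else φ x

/-- The function `ρ̄`, extended so that `-ρ̄` equals `φ` outside `U`; the lower obstacle
is `-ρ̄`. -/
def rhoBar {n : ℕ} (K U : Set (Rn n)) (φ : Rn n → ℝ) (x : Rn n) : ℝ :=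
  open Classical in
  if x ∈ U then ⨅ y : frontier U, (gauge K (y - x) - φ y) else -φ x

/-- `φ` is convex on a neighborhood `N` of the set `S`. Since `N` need not be a convex set, this
means that `φ` is convex on the convex subsets of `N`. -/
def ConvexNear {n : ℕ} (S : Set (Rn n)) (φ : Rn n → ℝ) : Prop :=
  ∃ N : Set (Rn n), IsOpen N ∧ S ⊆ N ∧ ∀ C ⊆ N, Convex ℝ C → ConvexOn ℝ C φ

/-! ### Viscosity solutions

An equation is given by `F x r p u`, which stands for `-Ĩ(x, u(x), Du(x), u(·))` with `r = u(x)` and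
`p = Du(x)`. -/

/-- `u` is a viscosity subsolution of `F ≤ 0` in `U`. -/
def IsViscositySub {n : ℕ} (F : Rn n → ℝ → Rn n → (Rn n → ℝ) → ℝ) (U : Set (Rn n))
    (u : Rn n → ℝ) : Prop :=
  UpperSemicontinuous u ∧
    ∀ (ψ : Rn n → ℝ) (x₀ : Rn n), IsBdd ψ → ContDiff ℝ 2 ψ → x₀ ∈ U →
      (∀ x, u x - ψ x ≤ u x₀ - ψ x₀) → F x₀ (u x₀) (gradient ψ x₀) ψ ≤ 0

/-- `u` is a viscosity supersolution of `F ≥ 0` in `U`. -/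
def IsViscositySuper {n : ℕ} (F : Rn n → ℝ → Rn n → (Rn n → ℝ) → ℝ) (U : Set (Rn n))
    (u : Rn n → ℝ) : Prop :=
  LowerSemicontinuous u ∧
    ∀ (ψ : Rn n → ℝ) (x₀ : Rn n), IsBdd ψ → ContDiff ℝ 2 ψ → x₀ ∈ U →
      (∀ x, u x₀ - ψ x₀ ≤ u x - ψ x) → 0 ≤ F x₀ (u x₀) (gradient ψ x₀) ψ

/-- `u` is a viscosity solution of `F = 0` in `U`. -/
def IsViscositySol {n : ℕ} (F : Rn n → ℝ → Rn n → (Rn n → ℝ) → ℝ) (U : Set (Rn n))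
    (u : Rn n → ℝ) : Prop :=
  Continuous u ∧ IsViscositySub F U u ∧ IsViscositySuper F U u

/-- The expression `-Iu`. -/
def negOp {n : ℕ} (I : (Rn n → ℝ) → Rn n → ℝ) :
    Rn n → ℝ → Rn n → (Rn n → ℝ) → ℝ :=
  fun x _ _ w => -I w x

/-- The expression `max{min{-Iu, u + ρ̄}, u - ρ}`. -/
def doubleObstacleOp {n : ℕ} (I : (Rn n → ℝ) → Rn n → ℝ) (K U : Set (Rn n)) (φ : Rn n → ℝ) :
    Rn n → ℝ → Rn n → (Rn n → ℝ) → ℝ :=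
  fun x r _ w => max (min (-I w x) (r + rhoBar K U φ x)) (r - rho K U φ x)

/-- The expression `max{-Iu, γ°(Du) - 1}`. -/
def gradConstraintOp {n : ℕ} (I : (Rn n → ℝ) → Rn n → ℝ) (K : Set (Rn n)) :
    Rn n → ℝ → Rn n → (Rn n → ℝ) → ℝ :=
  fun x _ p w => max (-I w x) (gauge (polarSet K) p - 1)

/-- `u` is a viscosity solution of the exterior value problem `F = 0` in `U`, `u = φ` in
`ℝⁿ - U`. -/
def SolvesDirichlet {n : ℕ} (F : Rn n → ℝ → Rn n → (Rn n → ℝ) → ℝ) (U : Set (Rn n))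
    (φ u : Rn n → ℝ) : Prop :=
  IsViscositySol F U u ∧ ∀ x, x ∉ U → u x = φ x

end NonlocalGradient

end

/-! Two global facts about `u` carry the proof: it is Lipschitz for the gauge, `u (x + h) ≤ u x +
gauge K h` (`sub_le_gauge_of_solution`), and it lies above the subsolution `v`
(`subsolution_le_solution`).

Let a test function `ψ` touch `u` from above at `x₀`. The Lipschitz bound gives `⟨Dψ, y⟩ ≤ 1` for `y
∈ K`, so `Dψ` lies in the polar. The obstacle problem gives `-Iψ ≤ 0` unless `u` is on the lower
obstacle; there the obstacle, `v` and `u` coincide, so `ψ` touches `v` too, and `v` is a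
subsolution. If `ψ` touches from below, then `-Iψ ≥ 0` or `u` is on the upper obstacle. In the
latter case `u x₀ = gauge K (x₀ - y) + φ y` for some `y ∈ frontier U`; as `u y = φ y`, the Lipschitz
bound is saturated along the segment from `x₀` to `y`, which forces the polar gauge of `Dψ` to be at
least 1.

Both global facts follow from `comparison_principle`, whose viscosity hypotheses are needed only
where the desired inequality fails. For the Lipschitz bound, `u (· + h)` is compared with `u + gauge
K h`. Boundary data and obstacles settle the points where `x` or `x + h` is outside `U`. Where the
bound fails, the Lipschitz property of the obstacles keeps `u (x + h)` off the lower one and `u x`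
off the upper one, so the inequalities for `I` are available.

Comparison itself doubles variables with a fixed penalty. At the maximum, the second difference of
the test functions is at most quadratic near 0, at most `ε` farther out and below a negative
constant far away. Ellipticity sees that far region, so `M⁺` is strictly negative, contrary to the
viscosity inequalities. -/

noncomputable section

namespace NonlocalGradient

/-! ### Integrability of the kernels -/

variable {n : ℕ} {s lam Lam : ℝ}

/-- The kernel `‖y‖^{-(n+2s)}` of the fractional Laplacian, without its constant. -/
def fracKernel (n : ℕ) (s : ℝ) (y : Rn n) : ℝ := 1 / ‖y‖ ^ ((n : ℝ) + 2 * s)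

theorem fracKernel_nonneg (y : Rn n) : 0 ≤ fracKernel n s y := by
  unfold fracKernel; positivity

theorem measurable_fracKernel : Measurable (fracKernel n s) := by
  unfold fracKernel; fun_prop

/-- In polar coordinates the radial integrand is `t ^ (1 - 2s)` on `(0, 1]`, integrable since `s <
1`, and `t ^ (-1 - 2s)` beyond, integrable since `s > 0`. -/
theorem integrable_min_mul_fracKernel (hn : 0 < n) (hs0 : 0 < s) (hs : s < 1) :
    Integrable (fun y : Rn n => min 1 (‖y‖ ^ 2) * fracKernel n s y) := by
  have : Nonempty (Fin n) := ⟨⟨0, hn⟩⟩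
  have key := integrable_fun_norm_addHaar (volume : Measure (Rn n))
    (f := fun t : ℝ => min 1 (t ^ 2) * (1 / t ^ ((n : ℝ) + 2 * s)))
  refine key.2 ?_
  rw [finrank_euclideanSpace_fin, ← Ioc_union_Ioi_eq_Ioi (zero_le_one : (0 : ℝ) ≤ 1)]
  have hpow : ∀ t : ℝ, 0 < t → t ^ (n - 1) = t ^ ((n : ℝ) - 1) := by
    intro t ht
    rw [← Real.rpow_natCast, Nat.cast_sub hn, Nat.cast_one]
  refine IntegrableOn.union ?_ ?_
  · have h1 : IntegrableOn (fun t : ℝ => t ^ (1 - 2 * s)) (Ioc 0 1) :=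
      (intervalIntegrable_iff_integrableOn_Ioc_of_le zero_le_one).1
        (intervalIntegral.intervalIntegrable_rpow' (by linarith))
    refine h1.congr_fun (fun t ht => ?_) measurableSet_Ioc
    have ht0 : 0 < t := ht.1
    have hm : min 1 (t ^ 2) = t ^ (2 : ℝ) := by
      rw [min_eq_right (by nlinarith [ht.2])]; norm_cast
    simp only [smul_eq_mul]
    rw [hm, hpow t ht0, one_div, ← Real.rpow_neg ht0.le, ← Real.rpow_add ht0,
      ← Real.rpow_add ht0]
    congr 1; ring
  · have h1 : IntegrableOn (fun t : ℝ => t ^ (-1 - 2 * s)) (Ioi 1) :=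
      integrableOn_Ioi_rpow_of_lt (by linarith) zero_lt_one
    refine h1.congr_fun (fun t ht => ?_) measurableSet_Ioi
    have ht1 : 1 < t := ht
    have ht0 : 0 < t := by linarith
    have hm : min 1 (t ^ 2) = 1 := min_eq_left (by nlinarith)
    simp only [smul_eq_mul]
    rw [hm, one_mul, hpow t ht0, one_div, ← Real.rpow_neg ht0.le, ← Real.rpow_add ht0]
    congr 1; ring

theorem classL0_nonempty (hn : 0 < n) (hs0 : 0 < s) (hs : s < 1) (hlam : 0 < lam)
    (hLam : lam ≤ Lam) : (classL0 n s lam Lam).Nonempty := by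
  have h1s : 0 < 1 - s := by linarith
  refine ⟨fun y => (1 - s) * lam * fracKernel n s y, ⟨?_, ?_, ?_, ?_⟩, ?_⟩
  · exact measurable_fracKernel.const_mul _
  · intro y hy
    have : 0 < ‖y‖ := norm_pos_iff.2 hy
    unfold fracKernel
    positivity
  · intro y; simp [fracKernel]
  · refine ((integrable_min_mul_fracKernel hn hs0 hs).const_mul ((1 - s) * lam)).congr
      (ae_of_all _ fun y => ?_)
    simp only; ring
  · intro y hy
    have e : (1 - s) * lam * fracKernel n s y = (1 - s) * (lam / ‖y‖ ^ ((n : ℝ) + 2 * s)) := by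
      unfold fracKernel; ring
    simp only [e]
    refine ⟨le_rfl, ?_⟩
    gcongr

/-- Kernels of the class are integrable against functions of size `min 1 ‖y‖²`. -/
theorem integrable_mul_kernel {a : Rn n → ℝ} (ha : Integrable fun y => min 1 (‖y‖ ^ 2) * a y)
    (ham : Measurable a) {f : Rn n → ℝ} (hf : Measurable f) {C : ℝ}
    (hC : ∀ y, |f y| ≤ C * min 1 (‖y‖ ^ 2)) : Integrable fun y => f y * a y := by
  refine (ha.norm.const_mul C).mono' (hf.mul ham).aestronglyMeasurable (ae_of_all _ fun y => ?_)
  have hm : 0 ≤ min 1 (‖y‖ ^ 2) := by positivity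
  rw [norm_mul, norm_mul, Real.norm_eq_abs, Real.norm_eq_abs (min _ _), abs_of_nonneg hm,
    ← mul_assoc]
  exact mul_le_mul_of_nonneg_right (hC y) (norm_nonneg _)

/-- Dominated convergence: each `y ≠ 0` leaves the ball eventually, and the integrand vanishes at 0.
-/
theorem tendsto_integral_ball_fracKernel (hn : 0 < n) (hs0 : 0 < s) (hs : s < 1) :
    Tendsto (fun r : ℝ => ∫ y in Metric.ball (0 : Rn n) r, ‖y‖ ^ 2 * fracKernel n s y)
      (𝓝[>] 0) (𝓝 0) := by
  have hint := integrable_min_mul_fracKernel (n := n) hn hs0 hs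
  simp_rw [← integral_indicator measurableSet_ball]
  rw [show (𝓝 (0 : ℝ)) = 𝓝 (∫ _ : Rn n, (0 : ℝ)) by rw [integral_zero]]
  refine tendsto_integral_filter_of_dominated_convergence _ ?_ ?_ hint ?_
  · refine Eventually.of_forall fun r => Measurable.aestronglyMeasurable ?_
    refine Measurable.indicator ?_ measurableSet_ball
    exact (by fun_prop : Measurable fun y : Rn n => ‖y‖ ^ 2).mul measurable_fracKernel
  · filter_upwards [Ioo_mem_nhdsGT zero_lt_one] with r hr
    refine ae_of_all _ fun y => ?_
    have hk := fracKernel_nonneg (s := s) y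
    by_cases hy : y ∈ Metric.ball (0 : Rn n) r
    · rw [indicator_of_mem hy, Real.norm_of_nonneg (by positivity), min_eq_right]
      have : ‖y‖ < r := by simpa using hy
      have : ‖y‖ < 1 := this.trans hr.2
      nlinarith [norm_nonneg y]
    · rw [indicator_of_notMem hy, norm_zero]; positivity
  · refine ae_of_all _ fun y => ?_
    by_cases hy : y = 0
    · refine tendsto_const_nhds.congr fun r => ?_
      subst hy
      simp [indicator]
    · refine tendsto_const_nhds.congr' ?_
      filter_upwards [Ioo_mem_nhdsGT (norm_pos_iff.2 hy)] with r hr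
      rw [indicator_of_notMem]
      simpa using hr.2.le

end NonlocalGradient
end

/-! ### Uniform negativity of the integrals, and doubling of variables -/

noncomputable section

namespace NonlocalGradient

variable {n : ℕ} {s lam Lam : ℝ}

theorem integrable_indicator_fracKernel (hn : 0 < n) (hs0 : 0 < s) (hs : s < 1) {ρ : ℝ}
    (hρ : 0 < ρ) : Integrable ({y : Rn n | ρ ≤ ‖y‖}.indicator (fracKernel n s)) := by
  have hint := integrable_min_mul_fracKernel (n := n) hn hs0 hs
  have hms : MeasurableSet {y : Rn n | ρ ≤ ‖y‖} := measurableSet_le (by fun_prop) (by fun_prop)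
  refine (hint.const_mul (1 / min 1 (ρ ^ 2))).mono'
    (measurable_fracKernel.indicator hms).aestronglyMeasurable (ae_of_all _ fun y => ?_)
  have hk := fracKernel_nonneg (s := s) y
  have hm : 0 < min 1 (ρ ^ 2) := by positivity
  by_cases hy : ρ ≤ ‖y‖
  · rw [indicator_of_mem (by exact hy), Real.norm_of_nonneg hk, ← mul_assoc]
    refine le_mul_of_one_le_left hk ?_
    rw [one_div, inv_mul_eq_div, one_le_div hm]
    gcongr
  · rw [indicator_of_notMem (by exact hy), norm_zero]; positivity

theorem integrable_indicator_ball_fracKernel (hn : 0 < n) (hs0 : 0 < s) (hs : s < 1) {r : ℝ}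
    (hr : r ≤ 1) : Integrable ((Metric.ball (0 : Rn n) r).indicator
      fun y => ‖y‖ ^ 2 * fracKernel n s y) := by
  refine (integrable_min_mul_fracKernel (n := n) hn hs0 hs).mono' ?_ (ae_of_all _ fun y => ?_)
  · refine (Measurable.indicator ?_ measurableSet_ball).aestronglyMeasurable
    exact (by fun_prop : Measurable fun y : Rn n => ‖y‖ ^ 2).mul measurable_fracKernel
  · have hk := fracKernel_nonneg (s := s) y
    by_cases hy : y ∈ Metric.ball (0 : Rn n) r
    · rw [indicator_of_mem hy, Real.norm_of_nonneg (by positivity), min_eq_right]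
      have : ‖y‖ < 1 := (by simpa using hy : ‖y‖ < r).trans_le hr
      nlinarith [norm_nonneg y]
    · rw [indicator_of_notMem hy, norm_zero]; positivity

theorem integral_indicator_fracKernel_pos (hn : 0 < n) (hs0 : 0 < s) (hs : s < 1) {ρ : ℝ}
    (hρ : 0 < ρ) : 0 < ∫ y, {y : Rn n | ρ ≤ ‖y‖}.indicator (fracKernel n s) y := by
  have : Nonempty (Fin n) := ⟨⟨0, hn⟩⟩
  rw [integral_pos_iff_support_of_nonneg
    (fun y => indicator_nonneg (fun y _ => fracKernel_nonneg y) y)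
    (integrable_indicator_fracKernel hn hs0 hs hρ)]
  have hopen : IsOpen {y : Rn n | ρ < ‖y‖} := isOpen_lt (by fun_prop) (by fun_prop)
  refine (hopen.measure_pos volume (NormedSpace.exists_lt_norm ℝ (Rn n) ρ)).trans_le
    (measure_mono fun y hy => ?_)
  have hy' : ρ < ‖y‖ := hy
  have : 0 < ‖y‖ := hρ.trans hy'
  rw [Function.mem_support, indicator_of_mem (show y ∈ {y : Rn n | ρ ≤ ‖y‖} from hy'.le)]
  unfold fracKernel
  positivity

/-- A second difference which is at most quadratic near the origin, almost nonpositive everywhere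
and negative far away is uniformly negative after integration against the kernels of the class. -/
theorem exists_integral_mul_kernel_le_neg (hn : 0 < n) (hs0 : 0 < s) (hs : s < 1)
    (hlam : 0 < lam) (hLam : lam ≤ Lam) {c m R : ℝ} (hc : 0 ≤ c) (hm : 0 < m) (hR : 0 < R) :
    ∃ r ε κ : ℝ, 0 < r ∧ r ≤ 1 ∧ r ≤ R ∧ 0 < ε ∧ 0 < κ ∧
      ∀ a ∈ classL0 n s lam Lam, ∀ D : Rn n → ℝ, Measurable D →
        (∃ C, ∀ y, |D y| ≤ C * min 1 (‖y‖ ^ 2)) →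
        (∀ y, ‖y‖ < r → D y ≤ c * ‖y‖ ^ 2 + if r / 2 ≤ ‖y‖ then ε else 0) →
        (∀ y, r ≤ ‖y‖ → D y ≤ ε) →
        (∀ y, R ≤ ‖y‖ → D y ≤ ε - m) → ∫ y, D y * a y ≤ -κ := by
  have h1s : 0 < 1 - s := by linarith
  set J := ∫ y, {y : Rn n | R ≤ ‖y‖}.indicator (fracKernel n s) y with hJ
  have hJpos : 0 < J := integral_indicator_fracKernel_pos hn hs0 hs hR
  set C₁ := (1 - s) * Lam
  set c₁ := (1 - s) * lam
  have hC₁ : 0 < C₁ := mul_pos h1s (hlam.trans_le hLam)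
  have hc₁ : 0 < c₁ := mul_pos h1s hlam
  -- The far region contributes at most `-c₁ * m * J = -3κ`. The quadratic part near 0 and the `ε`
  -- part may each consume one `κ`, leaving `-κ`.
  set κ := c₁ * m * J / 3 with hκ
  have hκpos : 0 < κ := by positivity
  obtain ⟨r, hrκ, hr⟩ : ∃ r : ℝ, C₁ * c * (∫ y in Metric.ball (0 : Rn n) r,
      ‖y‖ ^ 2 * fracKernel n s y) < κ ∧ r ∈ Ioo 0 (min 1 R) := by
    have h := (tendsto_integral_ball_fracKernel (n := n) hn hs0 hs).const_mul (C₁ * c)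
    rw [mul_zero] at h
    exact ((h.eventually_lt_const hκpos).and (Ioo_mem_nhdsGT (by positivity))).exists
  have hr0 : 0 < r := hr.1
  have hr1 : r < 1 := hr.2.trans_le (min_le_left _ _)
  have hrR : r < R := hr.2.trans_le (min_le_right _ _)
  set E := ∫ y, {y : Rn n | r / 2 ≤ ‖y‖}.indicator (fracKernel n s) y with hE
  have hEpos : 0 < E := integral_indicator_fracKernel_pos hn hs0 hs (by positivity)
  -- `ε` is chosen after `r`, so that `C₁ * ε * E = κ`. The cutoff at `r / 2` allows for the annulus
  -- where a bump function passes from 1 to 0.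
  refine ⟨r, κ / (C₁ * E), κ, hr0, hr1.le, hrR.le, by positivity, hκpos, ?_⟩
  intro a ha D hD ⟨C, hDC⟩ h1 h2 h3
  set ε := κ / (C₁ * E) with hε
  have hεpos : 0 < ε := by positivity
  have i1 := (integrable_indicator_ball_fracKernel (n := n) hn hs0 hs hr1.le).const_mul (C₁ * c)
  have i2 := (integrable_indicator_fracKernel (n := n) hn hs0 hs (half_pos hr0)).const_mul (C₁ * ε)
  have i3 := (integrable_indicator_fracKernel (n := n) hn hs0 hs hR).const_mul (c₁ * m)
  refine (integral_mono (integrable_mul_kernel ha.1.integrable ha.1.measurable hD hDC)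
    ((i1.add i2).sub i3) fun y => ?_).trans ?_
  · simp only [Pi.sub_apply, Pi.add_apply]
    by_cases hy0 : y = 0
    · have : D y = 0 := by
        have := hDC y
        rw [hy0] at this ⊢
        simpa using this
      have e2 : y ∉ {y : Rn n | r / 2 ≤ ‖y‖} := by simp [hy0, hr0]
      have e3 : y ∉ {y : Rn n | R ≤ ‖y‖} := by simp [hy0, hR]
      have e1 : (Metric.ball (0 : Rn n) r).indicator (fun y => ‖y‖ ^ 2 * fracKernel n s y) y = 0 := by
        simp [hy0, indicator]
      rw [this, e1, indicator_of_notMem e2, indicator_of_notMem e3]; simp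
    have hk := fracKernel_nonneg (s := s) y
    have hk1 : c₁ * fracKernel n s y ≤ a y := by
      refine le_of_eq_of_le ?_ (ha.2 y hy0).1
      simp only [c₁, fracKernel]; ring
    have hk2 : a y ≤ C₁ * fracKernel n s y := by
      refine (ha.2 y hy0).2.trans_eq ?_
      simp only [C₁, fracKernel]; ring
    have ha0 : 0 ≤ a y := (ha.1.pos y hy0).le
    have hεk : ε * a y ≤ ε * (C₁ * fracKernel n s y) := by gcongr
    by_cases hyr : ‖y‖ < r
    · have m1 : y ∈ Metric.ball (0 : Rn n) r := by simpa using hyr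
      have m3 : y ∉ {y : Rn n | R ≤ ‖y‖} := by simpa using hyr.trans hrR
      rw [indicator_of_mem m1, indicator_of_notMem m3]
      have hck : c * ‖y‖ ^ 2 * a y ≤ c * ‖y‖ ^ 2 * (C₁ * fracKernel n s y) := by gcongr
      have hle := mul_le_mul_of_nonneg_right (h1 y hyr) ha0
      by_cases hy2 : r / 2 ≤ ‖y‖
      · rw [indicator_of_mem (by exact hy2)]
        rw [if_pos hy2] at hle
        nlinarith
      · rw [indicator_of_notMem (by exact hy2)]
        rw [if_neg hy2] at hle
        nlinarith
    · rw [not_lt] at hyr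
      have m1 : y ∉ Metric.ball (0 : Rn n) r := by simpa using hyr
      have m2 : y ∈ {y : Rn n | r / 2 ≤ ‖y‖} := by
        show r / 2 ≤ ‖y‖
        linarith
      rw [indicator_of_notMem m1, indicator_of_mem m2]
      by_cases hyR : R ≤ ‖y‖
      · rw [indicator_of_mem (by exact hyR)]
        have hmk : m * (c₁ * fracKernel n s y) ≤ m * a y := by gcongr
        have hle := mul_le_mul_of_nonneg_right (h3 y hyR) ha0
        nlinarith
      · rw [indicator_of_notMem (by exact hyR)]
        have hle := mul_le_mul_of_nonneg_right (h2 y hyr) ha0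
        nlinarith
  · have i12 := i1.add i2
    rw [integral_sub' i12 i3, integral_add' i1 i2, integral_const_mul, integral_const_mul,
      integral_const_mul, integral_indicator measurableSet_ball, ← hJ, ← hE]
    have e1 : C₁ * ε * E = κ := by rw [hε]; field_simp
    have e2 : c₁ * m * J = 3 * κ := by rw [hκ]; ring
    rw [e1, e2]
    linarith

/-- The maximum point of the doubled function `v x - w y - c ‖x - y‖²`. -/
theorem exists_doubling_max {v w : Rn n → ℝ} {Ω : Set (Rn n)} (hv : UniformContinuous v)
    (hw : UniformContinuous w) (hvb : IsBdd v) (hwb : IsBdd w) (hΩ : Bornology.IsBounded Ω)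
    (hle : ∀ x, x ∉ Ω → v x ≤ w x) {x₀ : Rn n} (hx₀ : w x₀ < v x₀) :
    ∃ (c R : ℝ) (p x y : Rn n), 0 < c ∧ 0 < R ∧ 0 < v x - w y ∧ w x < v x ∧ w y < v y ∧
      (∀ z, v (x + z) ≤ v x + inner ℝ p z + c * ‖z‖ ^ 2) ∧
      (∀ z, w y + inner ℝ p z - c * ‖z‖ ^ 2 ≤ w (y + z)) ∧
      (∀ z, v (x + z) - w (y + z) ≤ v x - w y) ∧
      (∀ z, R ≤ ‖z‖ → v (x + z) - w (y + z) ≤ (v x - w y) / 2) := by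
  obtain ⟨Cv, hCv⟩ := hvb
  obtain ⟨Cw, hCw⟩ := hwb
  obtain ⟨ρ, hρ⟩ := hΩ.subset_closedBall (0 : Rn n)
  set m₀ := v x₀ - w x₀ with hm₀
  have hm₀pos : 0 < m₀ := sub_pos.2 hx₀
  obtain ⟨δ₁, hδ₁, h1⟩ := Metric.uniformContinuous_iff.1 hv (m₀ / 2) (half_pos hm₀pos)
  obtain ⟨δ₂, hδ₂, h2⟩ := Metric.uniformContinuous_iff.1 hw (m₀ / 2) (half_pos hm₀pos)
  set δ := min δ₁ δ₂
  have hδ : 0 < δ := lt_min hδ₁ hδ₂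
  have hvδ : ∀ x y, ‖x - y‖ < δ → |v x - v y| < m₀ / 2 := fun x y h => by
    have := h1 (a := x) (b := y) (by rw [dist_eq_norm]; exact h.trans_le (min_le_left _ _))
    rwa [Real.dist_eq] at this
  have hwδ : ∀ x y, ‖x - y‖ < δ → |w x - w y| < m₀ / 2 := fun x y h => by
    have := h2 (a := x) (b := y) (by rw [dist_eq_norm]; exact h.trans_le (min_le_right _ _))
    rwa [Real.dist_eq] at this
  have hCv0 : 0 ≤ Cv := (abs_nonneg _).trans (hCv 0)
  have hCw0 : 0 ≤ Cw := (abs_nonneg _).trans (hCw 0)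
  -- With this penalty `Φ` is negative once `‖x - y‖ ≥ δ`, so at a maximum `v` and `w` each vary by
  -- less than `m₀ / 2` between the two points. No limit in `c` is taken.
  set c := (Cv + Cw + 1) / δ ^ 2 with hc
  have hcpos : 0 < c := by positivity
  set Φ : Rn n × Rn n → ℝ := fun q => v q.1 - w q.2 - c * ‖q.1 - q.2‖ ^ 2 with hΦ
  have hΦc : Continuous Φ := by
    have := hv.continuous
    have := hw.continuous
    fun_prop
  have hfar : ∀ x y, δ ≤ ‖x - y‖ → Φ (x, y) < 0 := fun x y h => by
    have e : c * δ ^ 2 = Cv + Cw + 1 := by rw [hc]; field_simp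
    have h3 : c * δ ^ 2 ≤ c * ‖x - y‖ ^ 2 := by gcongr
    have := (abs_le.1 (hCv x)).2
    have := (abs_le.1 (hCw y)).1
    simp only [hΦ]
    linarith
  have hoff : ∀ x y, ‖x - y‖ < δ → y ∉ Ω → v x - w y ≤ m₀ / 2 := fun x y h hy => by
    have := (abs_lt.1 (hvδ x y h)).2
    have := hle y hy
    linarith
  have hx₀Ω : x₀ ∈ Ω := by_contra fun h => absurd (hle x₀ h) (not_le.2 hx₀)
  set S := Metric.closedBall (0 : Rn n) (ρ + δ) ×ˢ Metric.closedBall (0 : Rn n) (ρ + δ) with hS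
  have hScomp : IsCompact S := (isCompact_closedBall _ _).prod (isCompact_closedBall _ _)
  have hx₀S : (x₀, x₀) ∈ S := by
    have := hρ hx₀Ω
    simp only [hS, mem_prod, Metric.mem_closedBall, dist_zero_right] at this ⊢
    exact ⟨by linarith, by linarith⟩
  obtain ⟨⟨x, y⟩, hxyS, hmax⟩ := hScomp.exists_isMaxOn ⟨_, hx₀S⟩ hΦc.continuousOn
  have hΦ₀ : m₀ ≤ Φ (x, y) := by
    have : Φ (x₀, x₀) ≤ Φ (x, y) := hmax hx₀S
    simpa [hΦ, ← hm₀] using this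
  have hglob : ∀ x' y', Φ (x', y') ≤ Φ (x, y) := by
    intro x' y'
    by_cases hd : δ ≤ ‖x' - y'‖
    · linarith [hfar x' y' hd]
    rw [not_le] at hd
    by_cases hy' : y' ∈ Ω
    · refine hmax ?_
      have h4 := hρ hy'
      have h5 : ‖x'‖ ≤ ‖x' - y'‖ + ‖y'‖ := by simpa using norm_add_le (x' - y') y'
      simp only [hS, mem_prod, Metric.mem_closedBall, dist_zero_right] at h4 ⊢
      exact ⟨by linarith, by linarith⟩
    · have h6 := hoff x' y' hd hy'
      have h7 : 0 ≤ c * ‖x' - y'‖ ^ 2 := by positivity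
      have : Φ (x', y') ≤ m₀ / 2 := by simp only [hΦ]; linarith
      linarith
  have hd : ‖x - y‖ < δ := by
    by_contra h
    linarith [hfar x y (not_lt.1 h)]
  have hm : m₀ ≤ v x - w y := by
    have h7 : 0 ≤ c * ‖x - y‖ ^ 2 := by positivity
    simp only [hΦ] at hΦ₀
    linarith
  refine ⟨c, |ρ| + ‖y‖ + 1, (2 * c) • (x - y), x, y, hcpos, by positivity, by linarith, ?_, ?_, ?_,
    ?_, ?_, ?_⟩
  · have := (abs_lt.1 (hwδ x y hd)).2
    linarith
  · have := (abs_lt.1 (hvδ x y hd)).2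
    linarith
  · intro z
    have h := hglob (x + z) y
    have e : ‖x + z - y‖ ^ 2 = ‖x - y‖ ^ 2 + 2 * inner ℝ (x - y) z + ‖z‖ ^ 2 := by
      rw [← norm_add_sq_real]; congr 2; abel
    simp only [hΦ, e] at h
    rw [real_inner_smul_left]
    linarith
  · intro z
    have h := hglob x (y + z)
    have e : ‖x - (y + z)‖ ^ 2 = ‖x - y‖ ^ 2 - 2 * inner ℝ (x - y) z + ‖z‖ ^ 2 := by
      rw [← norm_sub_sq_real]; congr 2; abel
    simp only [hΦ, e] at h
    rw [real_inner_smul_left]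
    linarith
  · intro z
    have h := hglob (x + z) (y + z)
    simp only [hΦ, add_sub_add_right_eq_sub] at h
    linarith
  -- For large `z` the point `y + z` has left `Ω`, where `v ≤ w`; uniform continuity then costs at
  -- most `m₀ / 2`, half of the maximal gap or less.
  · intro z hz
    have : y + z ∉ Ω := fun hmem => by
      have h4 := hρ hmem
      have h5 : ‖z‖ ≤ ‖y + z‖ + ‖y‖ := by
        have := norm_sub_le (y + z) y
        simpa using this
      simp only [Metric.mem_closedBall, dist_zero_right] at h4
      linarith [le_abs_self ρ]
    have := hoff (x + z) (y + z) (by rwa [add_sub_add_right_eq_sub]) this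
    linarith

end NonlocalGradient
end

/-! ### Test functions and the comparison principle -/

noncomputable section

namespace NonlocalGradient

variable {n : ℕ} {s lam Lam : ℝ}

theorem isC11At_of_eq_quadratic {f : Rn n → ℝ} {x p : Rn n} {c r : ℝ} (hr : 0 < r)
    (h : ∀ z, ‖z‖ < r → f (x + z) = f x + inner ℝ p z + c * ‖z‖ ^ 2) : IsC11At f x := by
  refine ⟨p, p, c • ContinuousLinearMap.id ℝ (Rn n), c • ContinuousLinearMap.id ℝ (Rn n), ?_⟩
  filter_upwards [Metric.ball_mem_nhds x hr] with z hz
  have h1 := h (z - x) (by rwa [← dist_eq_norm])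
  rw [add_sub_cancel] at h1
  have h2 : inner ℝ ((c • ContinuousLinearMap.id ℝ (Rn n)) (z - x)) (z - x)
      = c * ‖z - x‖ ^ 2 := by
    change inner ℝ (c • (z - x)) (z - x) = _
    rw [real_inner_smul_left, real_inner_self_eq_norm_sq]
  rw [h2, h1]
  exact ⟨le_rfl, le_rfl⟩

/-- A bounded `C²` function touching `f` from above at `x`, which equals a given quadratic polynomial
near `x`, and is uniformly close to `f` away from `x`. -/
theorem exists_test_function {f : Rn n → ℝ} (hf : UniformContinuous f) (hfb : IsBdd f)
    {x p : Rn n} {c : ℝ} (hq : ∀ z, f (x + z) ≤ f x + inner ℝ p z + c * ‖z‖ ^ 2)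
    (η : ContDiffBump (0 : Rn n)) {ε : ℝ} (hε : 0 < ε) :
    ∃ ψ : Rn n → ℝ, ContDiff ℝ 2 ψ ∧ IsBdd ψ ∧ ψ x = f x ∧ (∀ z, f z ≤ ψ z) ∧
      (∀ z, ‖z‖ < η.rIn → ψ (x + z) = ψ x + inner ℝ p z + c * ‖z‖ ^ 2) ∧
      ∀ z, ψ (x + z) ≤ η z * (f x + inner ℝ p z + c * ‖z‖ ^ 2) +
        (1 - η z) * (f (x + z) + ε) := by
  -- A smooth uniform approximation, raised by `ε / 2`, lies between `f` and `f + ε`; the bump `η`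
  -- glues it to the quadratic polynomial.
  obtain ⟨g₀, hg₀, hgf⟩ := hf.exists_contDiff_dist_le (half_pos hε)
  set g : Rn n → ℝ := fun z => g₀ z + ε / 2 with hg
  have hgc : ContDiff ℝ 2 g := (contDiff_infty.1 hg₀ 2).add contDiff_const
  have hfg : ∀ z, f z ≤ g z ∧ g z ≤ f z + ε := fun z => by
    have := abs_lt.1 ((Real.dist_eq _ _).symm.trans_lt (hgf z))
    simp only [hg]
    constructor <;> linarith
  set q : Rn n → ℝ := fun z => f x + inner ℝ p z + c * ‖z‖ ^ 2 with hqdef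
  have hqc : ContDiff ℝ 2 q := by
    have h1 : ContDiff ℝ 2 fun z : Rn n => ‖z‖ ^ 2 := contDiff_norm_sq ℝ
    have h2 : ContDiff ℝ 2 fun z : Rn n => (inner ℝ p z : ℝ) := contDiff_const.inner ℝ contDiff_id
    exact (contDiff_const.add h2).add (contDiff_const.mul h1)
  have hηc : ContDiff ℝ 2 η := η.contDiff
  set ψ₀ : Rn n → ℝ := fun z => η z * q z + (1 - η z) * g (x + z) with hψ₀
  have hψ₀c : ContDiff ℝ 2 ψ₀ :=
    (hηc.mul hqc).add ((contDiff_const.sub hηc).mul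
      (hgc.comp (contDiff_const.add contDiff_id)))
  have hψ₀q : ∀ z, ‖z‖ ≤ η.rIn → ψ₀ z = q z := fun z hz => by
    have : η z = 1 := η.one_of_mem_closedBall (by simpa using hz)
    simp [hψ₀, this]
  have hη0 : ∀ z, 0 ≤ η z := fun z => η.nonneg
  have hη1 : ∀ z, 0 ≤ 1 - η z := fun z => sub_nonneg.2 η.le_one
  have hq0 : q 0 = f x := by simp [hqdef]
  have hψ₀0 : ψ₀ 0 = f x := by rw [hψ₀q 0 (by simpa using η.rIn_pos.le), hq0]
  refine ⟨fun z => ψ₀ (z - x), hψ₀c.comp (contDiff_id.sub contDiff_const), ?_, ?_, ?_, ?_, ?_⟩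
  · obtain ⟨C, hC⟩ := hfb
    have hcs : HasCompactSupport fun z => η z * q z := η.hasCompactSupport.mul_right
    obtain ⟨B, hB⟩ := (hηc.mul hqc).continuous.bounded_above_of_compact_support hcs
    refine ⟨B + (C + ε), fun z => ?_⟩
    have h1 := hB (z - x)
    have h2 : |(1 - η (z - x)) * g (x + (z - x))| ≤ C + ε := by
      rw [add_sub_cancel, abs_mul, abs_of_nonneg (hη1 _)]
      have h3 : |g z| ≤ C + ε := by
        have := abs_le.1 (hC z)
        have := hfg z
        rw [abs_le]; constructor <;> linarith
      exact (mul_le_of_le_one_left (abs_nonneg _) (by linarith [hη0 (z - x)])).trans h3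
    rw [Real.norm_eq_abs] at h1
    exact (abs_add_le _ _).trans (add_le_add h1 h2)
  · simp only [sub_self, hψ₀0]
  · intro z
    have h1 := hq (z - x)
    rw [add_sub_cancel] at h1
    have h2 := (hfg z).1
    simp only [hψ₀, add_sub_cancel]
    nlinarith [mul_le_mul_of_nonneg_left h1 (hη0 (z - x)),
      mul_le_mul_of_nonneg_left h2 (hη1 (z - x))]
  · intro z hz
    simp only [add_sub_cancel_left, sub_self, hψ₀0]
    exact hψ₀q z hz.le
  · intro z
    simp only [add_sub_cancel_left, hψ₀]
    gcongr
    · exact hη1 z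
    · exact (hfg _).2

/-- Comparison principle: the sub- and supersolution properties are only needed where `w < v`. -/
theorem comparison_principle (hn : 0 < n) (hs0 : 0 < s) (hs : s < 1)
    (hlam : 0 < lam) (hLam : lam ≤ Lam) {I : (Rn n → ℝ) → Rn n → ℝ}
    (hItrans : IsTranslationInvariant I) (hIell : IsUniformlyElliptic (classL0 n s lam Lam) I)
    {v w : Rn n → ℝ} {Ω : Set (Rn n)} (hv : UniformContinuous v)
    (hw : UniformContinuous w) (hvb : IsBdd v) (hwb : IsBdd w) (hΩ : Bornology.IsBounded Ω)
    (hle : ∀ x, x ∉ Ω → v x ≤ w x)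
    (hsub : ∀ x, w x < v x → ∀ ψ : Rn n → ℝ, IsBdd ψ → ContDiff ℝ 2 ψ →
      AdmissibleAt ψ x → (∀ z, v z - ψ z ≤ v x - ψ x) → 0 ≤ I ψ x)
    (hsuper : ∀ x, w x < v x → ∀ ψ : Rn n → ℝ, IsBdd ψ → ContDiff ℝ 2 ψ →
      AdmissibleAt ψ x → (∀ z, w x - ψ x ≤ w z - ψ z) → I ψ x ≤ 0) (x : Rn n) : v x ≤ w x := by
  by_contra hx₀
  rw [not_le] at hx₀
  obtain ⟨c, R, p, x, y, hc, hR, hm, hwx, hwy, hqv, hqw, hW, hWR⟩ :=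
    exists_doubling_max hv hw hvb hwb hΩ hle hx₀
  set m := v x - w y with hmdef
  obtain ⟨r, ε, κ, hr, hr1, hrR, hε, hκ, hint⟩ :=
    exists_integral_mul_kernel_le_neg (c := 4 * c) hn hs0 hs hlam hLam (by positivity) hm hR
  set η : ContDiffBump (0 : Rn n) := ⟨r / 2, r, half_pos hr, half_lt_self hr⟩ with hη
  obtain ⟨ψ, hψc, hψb, hψx, hvψ, hψq, hψle⟩ :=
    exists_test_function hv hvb hqv η (ε := ε / 4) (by positivity)
  have hwb' : IsBdd (-w) := by
    obtain ⟨C, hC⟩ := hwb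
    exact ⟨C, fun x => by simpa using hC x⟩
  obtain ⟨χ, hχc, hχb, hχy, hwχ, hχq, hχle⟩ :=
    exists_test_function (f := -w) hw.neg hwb' (x := y) (p := -p) (c := c)
      (fun z => by
        have := hqw z
        simp only [Pi.neg_apply, inner_neg_left]
        linarith) η (ε := ε / 4) (by positivity)
  simp only [Pi.neg_apply, inner_neg_left] at hχy hwχ hχq hχle
  have hχb' : IsBdd (-χ) := by
    obtain ⟨C, hC⟩ := hχb
    exact ⟨C, fun x => by simpa using hC x⟩
  have hadψ : AdmissibleAt ψ x :=
    ⟨hψc.continuous.measurable, hψb, isC11At_of_eq_quadratic (half_pos hr) hψq⟩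
  have hχq' : ∀ z, ‖z‖ < r / 2 → (-χ) (y + z) = (-χ) y + inner ℝ p z + (-c) * ‖z‖ ^ 2 := by
    intro z hz
    simp only [Pi.neg_apply, hχq z hz]
    ring
  have hadχ : AdmissibleAt (-χ) y :=
    ⟨hχc.neg.continuous.measurable, hχb', isC11At_of_eq_quadratic (half_pos hr) hχq'⟩
  have hIψ : 0 ≤ I ψ x := hsub x hwx ψ hψb hψc hadψ fun z => by
    have := hvψ z
    linarith
  have hIχ : I (-χ) y ≤ 0 := hsuper y hwy (-χ) hχb' hχc.neg hadχ fun z => by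
    have := hwχ z
    simp only [Pi.neg_apply]
    linarith
  -- Translation invariance moves the lower test function from `y` to `x`, so that ellipticity can
  -- be applied at a single point. The linear terms `p` of both quadratics then cancel.
  set τ : Rn n → ℝ := fun z => (-χ) (z - (x - y)) with hτ
  have hτy : ∀ z, τ (x + z) = (-χ) (y + z) := fun z => by
    simp only [hτ]
    rw [show x + z - (x - y) = y + z by abel]
  have hτx : τ x = (-χ) y := by simpa using hτy 0
  have hτc : Continuous τ := hχc.neg.continuous.comp (continuous_id.sub continuous_const)
  have hτb : IsBdd τ := by
    obtain ⟨C, hC⟩ := hχb'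
    exact ⟨C, fun x => hC _⟩
  have hadτ : AdmissibleAt τ x := by
    refine ⟨hτc.measurable, hτb, isC11At_of_eq_quadratic (half_pos hr) (p := p) (c := -c) ?_⟩
    intro z hz
    rw [hτy, hτx, hχq' z hz]
  have hIτ : I τ x ≤ 0 := by
    have := hItrans (-χ) (x - y) x (by rwa [sub_sub_cancel])
    rw [sub_sub_cancel] at this
    exact this.trans_le hIχ
  have hsup : 0 ≤ extremalSup (classL0 n s lam Lam) (ψ - τ) x := by
    have := (hIell ψ τ x hadψ hadτ).2
    linarith
  set D : Rn n → ℝ := secondDiff (ψ - τ) x with hD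
  have hDeq : ∀ z, D z = (ψ (x + z) + χ (y + z) - m) + (ψ (x + -z) + χ (y + -z) - m) := by
    intro z
    simp only [hD, secondDiff, Pi.sub_apply, sub_eq_add_neg x z, hτy, hτx, hψx, Pi.neg_apply, hχy,
      hmdef]
    ring
  have hη0 : ∀ z, 0 ≤ η z := fun z => η.nonneg
  have hη1 : ∀ z, 0 ≤ 1 - η z := fun z => sub_nonneg.2 η.le_one
  have hup : ∀ z, ψ (x + z) + χ (y + z) - m ≤
      η z * (2 * c * ‖z‖ ^ 2) + (1 - η z) * (v (x + z) - w (y + z) - m + ε / 2) := by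
    intro z
    have h1 := hψle z
    have h2 := hχle z
    have e : m = η z * (v x - w y) + (1 - η z) * m := by rw [hmdef]; ring
    nlinarith
  have hnear : ∀ z, ‖z‖ < r → ψ (x + z) + χ (y + z) - m ≤
      2 * c * ‖z‖ ^ 2 + if r / 2 ≤ ‖z‖ then ε / 2 else 0 := by
    intro z hz
    refine (hup z).trans ?_
    split_ifs with hz2
    · have h1 := hW z
      have h2 : η z * (2 * c * ‖z‖ ^ 2) ≤ 2 * c * ‖z‖ ^ 2 :=
        mul_le_of_le_one_left (by positivity) η.le_one
      have h3 : (1 - η z) * (v (x + z) - w (y + z) - m + ε / 2) ≤ (1 - η z) * (ε / 2) :=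
        mul_le_mul_of_nonneg_left (by linarith) (hη1 z)
      nlinarith [hη0 z]
    · have : η z = 1 := η.one_of_mem_closedBall (by simpa using (not_le.1 hz2).le)
      rw [this]; simp
  have hηfar : ∀ z, r ≤ ‖z‖ → η z = 0 := fun z hz => η.zero_of_le_dist (by simpa using hz)
  have hDm : Measurable D := by
    have h1 := hψc.continuous
    have : Continuous D := by
      have h2 : D = fun z => (ψ - τ) (x + z) + (ψ - τ) (x - z) - 2 * (ψ - τ) x := rfl
      rw [h2]
      have : Continuous (ψ - τ) := h1.sub hτc
      fun_prop
    exact this.measurable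
  have hDC : ∃ C, ∀ z, |D z| ≤ C * min 1 (‖z‖ ^ 2) := by
    obtain ⟨B₁, hB₁⟩ := hψb
    obtain ⟨B₂, hB₂⟩ := hχb
    have hB₁0 : 0 ≤ B₁ := (abs_nonneg _).trans (hB₁ 0)
    have hB₂0 : 0 ≤ B₂ := (abs_nonneg _).trans (hB₂ 0)
    set B := 2 * (B₁ + B₂ + m) with hB
    refine ⟨4 * c + B / (r / 2) ^ 2, fun z => ?_⟩
    by_cases hz : ‖z‖ < r / 2
    · have hz' : ‖-z‖ < r / 2 := by rwa [norm_neg]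
      have e : D z = 4 * c * ‖z‖ ^ 2 := by
        rw [hDeq, hψq z hz, hψq _ hz', hχq z hz, hχq _ hz', hψx, hχy]
        simp only [inner_neg_right, norm_neg, hmdef]
        ring
      have h1 : min 1 (‖z‖ ^ 2) = ‖z‖ ^ 2 := min_eq_right (by nlinarith [norm_nonneg z])
      rw [e, h1, abs_of_nonneg (by positivity)]
      gcongr
      exact le_add_of_nonneg_right (by positivity)
    · rw [not_lt] at hz
      have h1 : (r / 2) ^ 2 ≤ min 1 (‖z‖ ^ 2) := le_min (by nlinarith) (by gcongr)
      have h2 : |D z| ≤ B := by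
        rw [hDeq]
        have a1 := abs_le.1 (hB₁ (x + z))
        have a2 := abs_le.1 (hB₁ (x + -z))
        have a3 := abs_le.1 (hB₂ (y + z))
        have a4 := abs_le.1 (hB₂ (y + -z))
        rw [abs_le]
        constructor <;> linarith
      refine h2.trans ?_
      calc B = B / (r / 2) ^ 2 * (r / 2) ^ 2 := by field_simp
        _ ≤ (4 * c + B / (r / 2) ^ 2) * min 1 (‖z‖ ^ 2) := by
          gcongr
          exact le_add_of_nonneg_left (by positivity)
  have hneg : extremalSup (classL0 n s lam Lam) (ψ - τ) x ≤ -κ := by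
    -- Nonemptiness matters: the default `sSup ∅ = 0` would give no contradiction.
    refine csSup_le ((classL0_nonempty hn hs0 hs hlam hLam).image _) ?_
    rintro _ ⟨a, ha, rfl⟩
    refine hint a ha D hDm hDC ?_ ?_ ?_
    · intro z hz
      have h1 := hnear z hz
      have h2 := hnear (-z) (by rwa [norm_neg])
      rw [norm_neg] at h2
      rw [hDeq]
      split_ifs with h <;> simp only [h, if_true, if_false] at h1 h2 <;> linarith
    · intro z hz
      have h1 := hup z
      have h2 := hup (-z)
      have h3 := hW z
      have h4 := hW (-z)
      rw [hηfar z hz] at h1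
      rw [hηfar (-z) (by rwa [norm_neg])] at h2
      rw [hDeq]
      linarith
    · intro z hz
      have h1 := hup z
      have h2 := hup (-z)
      have h3 := hWR z hz
      have h4 := hWR (-z) (by rwa [norm_neg])
      rw [hηfar z (hrR.trans hz)] at h1
      rw [hηfar (-z) (by rw [norm_neg]; exact hrR.trans hz)] at h2
      rw [hDeq]
      linarith
  linarith

end NonlocalGradient
end

/-! ### Gauge, obstacles and polar -/

noncomputable section

namespace NonlocalGradient

variable {n : ℕ} {K U : Set (Rn n)} {φ u : Rn n → ℝ}

theorem gauge_sub_le (hK : Convex ℝ K) (hK0 : K ∈ 𝓝 0) (x y z : Rn n) :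
    gauge K (x - z) ≤ gauge K (x - y) + gauge K (y - z) := by
  have := gauge_add_le hK (absorbent_nhds_zero hK0) (x - y) (y - z)
  rwa [sub_add_sub_cancel] at this

theorem exists_gauge_le_mul_norm (hK0 : K ∈ 𝓝 0) :
    ∃ C : ℝ, 0 < C ∧ ∀ x : Rn n, gauge K x ≤ C * ‖x‖ := by
  obtain ⟨r, hr, hrK⟩ := Metric.mem_nhds_iff.1 hK0
  refine ⟨r⁻¹, inv_pos.2 hr, fun x => ?_⟩
  rw [inv_mul_eq_div, le_div_iff₀' hr]
  exact mul_gauge_le_norm hrK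

theorem uniformContinuous_of_gauge_bound (hK0 : K ∈ 𝓝 0)
    (hφ : ∀ x y, -gauge K (y - x) ≤ φ x - φ y ∧ φ x - φ y ≤ gauge K (x - y)) :
    UniformContinuous φ := by
  obtain ⟨C, hC, hCK⟩ := exists_gauge_le_mul_norm hK0
  refine (LipschitzWith.of_dist_le_mul (K := C.toNNReal) fun x y => ?_).uniformContinuous
  have h1 := hCK (x - y)
  have h2 := hCK (y - x)
  rw [norm_sub_rev] at h2
  rw [Real.dist_eq, dist_eq_norm, abs_le, Real.coe_toNNReal C hC.le]
  have := hφ x y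
  constructor <;> linarith

theorem uniformContinuous_of_eq_off_bounded {f g : Rn n → ℝ} (hf : Continuous f)
    (hg : UniformContinuous g) (hU : Bornology.IsBounded U) (h : ∀ x, x ∉ U → f x = g x) :
    UniformContinuous f := by
  obtain ⟨ρ, hρ⟩ := hU.subset_closedBall (0 : Rn n)
  have hcs : HasCompactSupport (f - g) :=
    HasCompactSupport.intro (isCompact_closedBall (0 : Rn n) ρ) fun x hx => by
      rw [Pi.sub_apply, h x fun hxU => hx (hρ hxU), sub_self]
  have := (hcs.uniformContinuous_of_continuous (hf.sub hg.continuous)).add hg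
  exact this.congr (by simp)

theorem isBdd_of_eq_off_bounded {f g : Rn n → ℝ} (hf : Continuous f)
    (hg : IsBdd g) (hU : Bornology.IsBounded U) (h : ∀ x, x ∉ U → f x = g x) : IsBdd f := by
  obtain ⟨ρ, hρ⟩ := hU.subset_closedBall (0 : Rn n)
  obtain ⟨B, hB⟩ := (isCompact_closedBall (0 : Rn n) ρ).exists_bound_of_continuousOn hf.continuousOn
  obtain ⟨C, hC⟩ := hg
  refine ⟨max B C, fun x => ?_⟩
  by_cases hx : x ∈ U
  · exact (hB x (hρ hx)).trans (le_max_left _ _)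
  · rw [h x hx]; exact (hC x).trans (le_max_right _ _)

theorem exists_lineMap_mem_frontier (hU : IsOpen U) {x z : Rn n} (hx : x ∈ U) (hz : z ∉ U) :
    ∃ t ∈ Icc (0 : ℝ) 1, x + t • (z - x) ∈ frontier U := by
  by_contra! h
  have hsub : segment ℝ x z ⊆ U ∪ (closure U)ᶜ := by
    intro y hy
    rw [segment_eq_image'] at hy
    obtain ⟨t, ht, rfl⟩ := hy
    have := h t ht
    rw [hU.frontier_eq, Set.mem_sdiff, not_and_not_right] at this
    by_cases hc : x + t • (z - x) ∈ closure U
    · exact Or.inl (this hc)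
    · exact Or.inr hc
  have hpre : IsPreconnected (segment ℝ x z) := (convex_segment x z).isPreconnected
  have := hpre.subset_left_of_subset_union hU isClosed_closure.isOpen_compl
    (disjoint_compl_right.mono_left subset_closure) hsub
    ⟨x, left_mem_segment ℝ x z, hx⟩
  exact hz (this (right_mem_segment ℝ x z))

/-- A segment leaving `U` crosses `frontier U` at a point where the gauge splits additively. -/
theorem exists_frontier_gauge_split (K : Set (Rn n)) (hU : IsOpen U) {x z : Rn n} (hx : x ∈ U)
    (hz : z ∉ U) : ∃ y ∈ frontier U, gauge K (x - y) + gauge K (y - z) = gauge K (x - z) ∧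
      gauge K (z - y) + gauge K (y - x) = gauge K (z - x) := by
  obtain ⟨t, ht, hy⟩ := exists_lineMap_mem_frontier hU hx hz
  have h1 : (0 : ℝ) ≤ 1 - t := sub_nonneg.2 ht.2
  refine ⟨_, hy, ?_, ?_⟩
  · rw [show x - (x + t • (z - x)) = t • (x - z) by module,
      show x + t • (z - x) - z = (1 - t) • (x - z) by module,
      gauge_smul_of_nonneg ht.1, gauge_smul_of_nonneg h1, smul_eq_mul, smul_eq_mul]
    ring
  · rw [show z - (x + t • (z - x)) = (1 - t) • (z - x) by module,
      show x + t • (z - x) - x = t • (z - x) by module,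
      gauge_smul_of_nonneg ht.1, gauge_smul_of_nonneg h1, smul_eq_mul, smul_eq_mul]
    ring

/-- This keeps the infima defining the obstacles from being over an empty type, where they default
to 0. -/
theorem frontier_nonempty_of_isBounded (hn : 0 < n) (hU : Bornology.IsBounded U)
    (hne : U.Nonempty) : (frontier U).Nonempty := by
  have : Nonempty (Fin n) := ⟨⟨0, hn⟩⟩
  refine nonempty_frontier_iff.2 ⟨hne, fun h => ?_⟩
  obtain ⟨ρ, hρ⟩ := hU.subset_closedBall (0 : Rn n)
  obtain ⟨x, hx⟩ := NormedSpace.exists_lt_norm ℝ (Rn n) ρ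
  have : x ∈ Metric.closedBall (0 : Rn n) ρ := hρ (h ▸ mem_univ x)
  rw [mem_closedBall_zero_iff] at this
  linarith

/-! ### The obstacles -/

theorem rho_of_mem {x : Rn n} (hx : x ∈ U) :
    rho K U φ x = ⨅ y : frontier U, (gauge K (x - y) + φ y) := if_pos hx

theorem rho_of_notMem {x : Rn n} (hx : x ∉ U) : rho K U φ x = φ x := if_neg hx

theorem rhoBar_of_mem {x : Rn n} (hx : x ∈ U) :
    rhoBar K U φ x = ⨅ y : frontier U, (gauge K (y - x) - φ y) := if_pos hx

theorem rhoBar_of_notMem {x : Rn n} (hx : x ∉ U) : rhoBar K U φ x = -φ x := if_neg hx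

theorem rho_le_gauge_add (hφ : IsBdd φ) {x y : Rn n} (hx : x ∈ U) (hy : y ∈ frontier U) :
    rho K U φ x ≤ gauge K (x - y) + φ y := by
  obtain ⟨C, hC⟩ := hφ
  rw [rho_of_mem hx]
  refine ciInf_le (f := fun y : frontier U => gauge K (x - y) + φ y) ⟨-C, ?_⟩ ⟨y, hy⟩
  rintro _ ⟨y, rfl⟩
  have := (abs_le.1 (hC y)).1
  have := gauge_nonneg (s := K) (x - y)
  simp only
  linarith

theorem rhoBar_le_gauge_sub (hφ : IsBdd φ) {x y : Rn n} (hx : x ∈ U) (hy : y ∈ frontier U) :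
    rhoBar K U φ x ≤ gauge K (y - x) - φ y := by
  obtain ⟨C, hC⟩ := hφ
  rw [rhoBar_of_mem hx]
  refine ciInf_le (f := fun y : frontier U => gauge K (y - x) - φ y) ⟨-C, ?_⟩ ⟨y, hy⟩
  rintro _ ⟨y, rfl⟩
  have := (abs_le.1 (hC y)).2
  have := gauge_nonneg (s := K) (y - x)
  simp only
  linarith

theorem rho_le_rho_add (hn : 0 < n) (hK : Convex ℝ K) (hK0 : K ∈ 𝓝 0)
    (hUb : Bornology.IsBounded U) (hφ : IsBdd φ) {x x' : Rn n} (hx : x ∈ U) (hx' : x' ∈ U) :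
    rho K U φ x ≤ rho K U φ x' + gauge K (x - x') := by
  have : Nonempty (frontier U) := (frontier_nonempty_of_isBounded hn hUb ⟨x, hx⟩).to_subtype
  rw [← sub_le_iff_le_add, rho_of_mem hx']
  refine le_ciInf fun y => ?_
  have h1 := rho_le_gauge_add (K := K) hφ hx y.2
  have h2 := gauge_sub_le hK hK0 x x' y
  linarith

theorem rhoBar_le_rhoBar_add (hn : 0 < n) (hK : Convex ℝ K) (hK0 : K ∈ 𝓝 0)
    (hUb : Bornology.IsBounded U) (hφ : IsBdd φ) {x x' : Rn n} (hx : x ∈ U) (hx' : x' ∈ U) :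
    rhoBar K U φ x ≤ rhoBar K U φ x' + gauge K (x' - x) := by
  have : Nonempty (frontier U) := (frontier_nonempty_of_isBounded hn hUb ⟨x, hx⟩).to_subtype
  rw [← sub_le_iff_le_add, rhoBar_of_mem hx']
  refine le_ciInf fun y => ?_
  have h1 := rhoBar_le_gauge_sub (K := K) hφ hx y.2
  have h2 := gauge_sub_le hK hK0 y x' x
  linarith

theorem exists_rho_eq (hn : 0 < n) (hK : Convex ℝ K) (hK0 : K ∈ 𝓝 0)
    (hUb : Bornology.IsBounded U) (hφ : Continuous φ) {x : Rn n} (hx : x ∈ U) :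
    ∃ y ∈ frontier U, rho K U φ x = gauge K (x - y) + φ y := by
  have hne := frontier_nonempty_of_isBounded hn hUb ⟨x, hx⟩
  have : Nonempty (frontier U) := hne.to_subtype
  have hcomp : IsCompact (frontier U) :=
    hUb.isCompact_closure.of_isClosed_subset isClosed_frontier frontier_subset_closure
  have hcont : Continuous fun y => gauge K (x - y) + φ y :=
    ((continuous_gauge hK hK0).comp (continuous_const.sub continuous_id)).add hφ
  obtain ⟨y, hy, hmin⟩ := hcomp.exists_isMinOn hne hcont.continuousOn
  refine ⟨y, hy, ?_⟩
  rw [rho_of_mem hx]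
  refine le_antisymm (ciInf_le (f := fun y : frontier U => gauge K (x - y) + φ y)
    ⟨gauge K (x - y) + φ y, ?_⟩ ⟨y, hy⟩) (le_ciInf fun z => hmin z.2)
  rintro _ ⟨z, rfl⟩
  exact hmin z.2

theorem continuousOn_of_gauge_bound {f : Rn n → ℝ} (hK0 : K ∈ 𝓝 0)
    (hf : ∀ x ∈ U, ∀ y ∈ U, f x ≤ f y + gauge K (x - y)) : ContinuousOn f U := by
  obtain ⟨C, hC, hCK⟩ := exists_gauge_le_mul_norm hK0
  refine (LipschitzOnWith.of_dist_le_mul (K := C.toNNReal) fun x hx y hy => ?_).continuousOn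
  have h1 := hCK (x - y)
  have h2 := hCK (y - x)
  rw [norm_sub_rev] at h2
  rw [Real.dist_eq, dist_eq_norm, abs_le, Real.coe_toNNReal C hC.le]
  have := hf x hx y hy
  have := hf y hy x hx
  constructor <;> linarith

theorem continuousOn_rho (hn : 0 < n) (hK : Convex ℝ K) (hK0 : K ∈ 𝓝 0)
    (hUb : Bornology.IsBounded U) (hφ : IsBdd φ) : ContinuousOn (rho K U φ) U :=
  continuousOn_of_gauge_bound hK0 fun _ hx _ hy => rho_le_rho_add hn hK hK0 hUb hφ hx hy

theorem continuousOn_rhoBar (hn : 0 < n) (hK : Convex ℝ K) (hK0 : K ∈ 𝓝 0)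
    (hUb : Bornology.IsBounded U) (hφ : IsBdd φ) : ContinuousOn (rhoBar K U φ) U := by
  have h : ContinuousOn (fun x => -rhoBar K U φ x) U :=
    continuousOn_of_gauge_bound hK0 fun x hx y hy => by
      linarith [rhoBar_le_rhoBar_add hn hK hK0 hUb hφ hy hx]
  exact h.neg.congr fun x _ => (neg_neg _).symm

/-- Points at which a bounded continuous function is touched from above are dense. -/
theorem exists_touching_from_above {f : Rn n → ℝ} (hf : Continuous f) (hfb : IsBdd f)
    (x₀ : Rn n) {r : ℝ} (hr : 0 < r) :
    ∃ (ψ : Rn n → ℝ) (x₁ : Rn n), IsBdd ψ ∧ ContDiff ℝ 2 ψ ∧ x₁ ∈ Metric.ball x₀ r ∧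
      ∀ x, f x - ψ x ≤ f x₁ - ψ x₁ := by
  obtain ⟨C, hC⟩ := hfb
  have hC0 : 0 ≤ C := (abs_nonneg _).trans (hC 0)
  set η : ContDiffBump x₀ := ⟨r / 2, r, half_pos hr, half_lt_self hr⟩ with hη
  -- A bump of this height outweighs the oscillation of `f`, at most `2 * C`, so the maximum lies in
  -- the open ball.
  set M := 2 * C + 1 with hM
  have hηc : ContDiff ℝ 2 η := η.contDiff
  have hgc : Continuous fun x => f x + M * η x := hf.add (continuous_const.mul hηc.continuous)
  obtain ⟨x₁, -, hmax⟩ := (isCompact_closedBall x₀ r).exists_isMaxOn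
    ⟨x₀, Metric.mem_closedBall_self hr.le⟩ hgc.continuousOn
  have h0 : -C + M ≤ f x₁ + M * η x₁ := by
    have h1 : f x₀ + M * η x₀ ≤ f x₁ + M * η x₁ := hmax (Metric.mem_closedBall_self hr.le)
    have h2 : η x₀ = 1 := η.one_of_mem_closedBall (Metric.mem_closedBall_self η.rIn_pos.le)
    rw [h2, mul_one] at h1
    linarith [(abs_le.1 (hC x₀)).1]
  have hfar : ∀ x, r ≤ dist x x₀ → f x + M * η x ≤ C := fun x hx => by
    have : η x = 0 := η.zero_of_le_dist hx
    rw [this, mul_zero, add_zero]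
    exact (abs_le.1 (hC x)).2
  refine ⟨fun x => -(M * η x), x₁, ⟨M, fun x => ?_⟩, (contDiff_const.mul hηc).neg, ?_, ?_⟩
  · rw [abs_neg, abs_mul, abs_of_nonneg (by positivity : 0 ≤ M), abs_of_nonneg η.nonneg]
    exact mul_le_of_le_one_right (by positivity) η.le_one
  · by_contra h
    have := hfar x₁ (by simpa using h)
    linarith
  · intro x
    simp only [sub_neg_eq_add]
    by_cases hx : x ∈ Metric.closedBall x₀ r
    · exact hmax hx
    · have := hfar x (le_of_lt (by simpa using hx))
      linarith

/-- The viscosity condition yields the bound only at points touched from above. These are dense,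
while the set in `U` where the bound fails is open. -/
theorem le_rho_of_sub (hn : 0 < n) (hK : Convex ℝ K) (hK0 : K ∈ 𝓝 0) (hU : IsOpen U)
    (hUb : Bornology.IsBounded U) (hφ : IsBdd φ) {I : (Rn n → ℝ) → Rn n → ℝ}
    (hu : Continuous u) (hub : IsBdd u) (huφ : ∀ x, x ∉ U → u x = φ x)
    (hsub : IsViscositySub (doubleObstacleOp I K U φ) U u) (x : Rn n) : u x ≤ rho K U φ x := by
  by_cases hx : x ∈ U
  · by_contra! h
    have hc := (continuousOn_rho hn hK hK0 hUb hφ).continuousAt (hU.mem_nhds hx)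
    obtain ⟨r, hr, hball⟩ := Metric.mem_nhds_iff.1
      ((hc.eventually_lt hu.continuousAt h).and (hU.mem_nhds hx))
    obtain ⟨ψ, x₁, hψb, hψc, hx₁, hmax⟩ := exists_touching_from_above hu hub x hr
    obtain ⟨h1, h2⟩ := hball hx₁
    have := (le_max_right _ _).trans (hsub.2 ψ x₁ hψb hψc h2 hmax)
    linarith
  · rw [rho_of_notMem hx, huφ x hx]

theorem neg_rhoBar_le_of_super (hn : 0 < n) (hK : Convex ℝ K) (hK0 : K ∈ 𝓝 0) (hU : IsOpen U)
    (hUb : Bornology.IsBounded U) (hφ : IsBdd φ) {I : (Rn n → ℝ) → Rn n → ℝ}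
    (hle : ∀ x, -rhoBar K U φ x ≤ rho K U φ x)
    (hu : Continuous u) (hub : IsBdd u) (huφ : ∀ x, x ∉ U → u x = φ x)
    (hsuper : IsViscositySuper (doubleObstacleOp I K U φ) U u) (x : Rn n) :
    -rhoBar K U φ x ≤ u x := by
  by_cases hx : x ∈ U
  · by_contra! h
    have hc : ContinuousAt (fun x => -rhoBar K U φ x) x :=
      ((continuousOn_rhoBar hn hK hK0 hUb hφ).continuousAt (hU.mem_nhds hx)).neg
    obtain ⟨r, hr, hball⟩ := Metric.mem_nhds_iff.1
      ((hu.continuousAt.eventually_lt hc h).and (hU.mem_nhds hx))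
    have hub' : IsBdd fun x => -u x := by
      obtain ⟨C, hC⟩ := hub
      exact ⟨C, fun x => by simpa using hC x⟩
    obtain ⟨ψ, x₁, ⟨B, hB⟩, hψc, hx₁, hmax⟩ := exists_touching_from_above hu.neg hub' x hr
    obtain ⟨h1, h2⟩ := hball hx₁
    have := hsuper.2 (fun x => -ψ x) x₁ ⟨B, fun x => by simpa using hB x⟩ hψc.neg h2
      fun x => by
        have := hmax x
        simp only [Pi.neg_apply] at this
        linarith
    rcases le_max_iff.1 this with h3 | h3
    · have := (le_min_iff.1 h3).2
      linarith
    · have := hle x₁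
      linarith
  · rw [rhoBar_of_notMem hx, huφ x hx, neg_neg]

/-! ### The polar gauge -/

theorem polarSet_mem_nhds (hKb : Bornology.IsBounded K) : polarSet K ∈ 𝓝 (0 : Rn n) := by
  obtain ⟨R, hR, hKR⟩ := hKb.subset_closedBall_lt 0 (0 : Rn n)
  refine Filter.mem_of_superset (Metric.ball_mem_nhds 0 (inv_pos.2 hR)) fun x hx y hy => ?_
  have h1 : ‖x‖ ≤ R⁻¹ := by simpa using (mem_ball_zero_iff.1 hx).le
  have h2 : ‖y‖ ≤ R := by simpa using hKR hy
  calc inner ℝ x y ≤ ‖x‖ * ‖y‖ := real_inner_le_norm x y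
    _ ≤ R⁻¹ * R := by gcongr
    _ = 1 := inv_mul_cancel₀ hR.ne'

theorem inner_le_gauge_of_mem_polarSet (hK0 : K ∈ 𝓝 0) {q : Rn n} (hq : q ∈ polarSet K)
    (z : Rn n) : inner ℝ q z ≤ gauge K z := by
  refine le_of_forall_gt_imp_ge_of_dense fun a ha => ?_
  obtain ⟨b, hb, hba, w, hw, rfl⟩ := exists_lt_of_gauge_lt (absorbent_nhds_zero hK0) ha
  have := hq w hw
  simp only [real_inner_smul_right]
  nlinarith

/-- Otherwise `p = b • q` with `b < 1` and `q` in the polar, so `⟨p, z⟩ ≤ b * gauge K z < gauge K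
z`. -/
theorem one_le_gauge_polarSet (hKb : Bornology.IsBounded K) (hK0 : K ∈ 𝓝 0) {p z : Rn n}
    (hz : z ≠ 0) (h : gauge K z ≤ inner ℝ p z) : 1 ≤ gauge (polarSet K) p := by
  by_contra! hlt
  obtain ⟨b, hb, hb1, q, hq, rfl⟩ :=
    exists_lt_of_gauge_lt (absorbent_nhds_zero (polarSet_mem_nhds hKb)) hlt
  have h1 := inner_le_gauge_of_mem_polarSet hK0 hq z
  have h2 : 0 < gauge K z := (gauge_pos (absorbent_nhds_zero hK0)
    (NormedSpace.isVonNBounded_of_isBounded ℝ hKb)).2 hz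
  simp only [real_inner_smul_left] at h
  nlinarith

theorem hasDerivAt_gradient_line {ψ : Rn n → ℝ} (hψ : ContDiff ℝ 2 ψ) (x z : Rn n) :
    HasDerivAt (fun t : ℝ => ψ (x + t • z)) (inner ℝ (gradient ψ x) z) 0 := by
  have h1 := ((hψ.differentiable (by norm_num)) x).hasGradientAt.hasFDerivAt
  have h2 : HasDerivAt (fun t : ℝ => x + t • z) z 0 := by
    simpa using ((hasDerivAt_id (0 : ℝ)).smul_const z).const_add x
  have h3 : x + (0 : ℝ) • z = x := by simp
  have := HasFDerivAt.comp_hasDerivAt (f := fun t : ℝ => x + t • z) (x := (0 : ℝ))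
    (l := ψ) (l' := InnerProductSpace.toDual ℝ (Rn n) (gradient ψ x)) (by rwa [h3]) h2
  rw [InnerProductSpace.toDual_apply_apply] at this
  exact this

theorem inner_gradient_le {ψ : Rn n → ℝ} (hψ : ContDiff ℝ 2 ψ) {x z : Rn n} {b : ℝ}
    (h : ∀ t ∈ Ioc (0 : ℝ) 1, ψ (x + t • z) - ψ x ≤ t * b) : inner ℝ (gradient ψ x) z ≤ b := by
  have hd := (hasDerivAt_gradient_line hψ x z).tendsto_slope_zero_right
  refine le_of_tendsto hd ?_
  filter_upwards [Ioc_mem_nhdsGT (zero_lt_one' ℝ)] with t ht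
  have := h t ht
  simp only [zero_add, zero_smul, add_zero, smul_eq_mul]
  rwa [inv_mul_le_iff₀ ht.1]

end NonlocalGradient
end

/-! ### Consequences of comparison for the obstacle problem -/

noncomputable section

namespace NonlocalGradient

variable {n : ℕ} {s lam Lam : ℝ} {I : (Rn n → ℝ) → Rn n → ℝ} {K U : Set (Rn n)} {φ u v : Rn n → ℝ}

theorem extremalSup_const (𝓛 : Set (Rn n → ℝ)) (c : ℝ) (x : Rn n) :
    extremalSup 𝓛 (fun _ => c) x = 0 := by
  have h : ∀ a : Rn n → ℝ, linearOp a (fun _ => c) x = 0 := fun a => by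
    have : ∀ y, secondDiff (fun _ : Rn n => c) x y = 0 := fun y => by
      simp only [secondDiff]; ring
    simp [linearOp, this]
  unfold extremalSup
  rcases 𝓛.eq_empty_or_nonempty with rfl | hne
  · simp
  · simp only [h]
    rw [hne.image_const, csSup_singleton]

theorem AdmissibleAt.sub_const {ψ : Rn n → ℝ} {x : Rn n} (h : AdmissibleAt ψ x) (c : ℝ) :
    AdmissibleAt (fun z => ψ z - c) x := by
  obtain ⟨hm, ⟨C, hC⟩, p, q, A, B, hAB⟩ := h
  refine ⟨hm.sub_const c, ⟨C + |c|, fun z => (abs_sub _ _).trans (by linarith [hC z])⟩,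
    p, q, A, B, ?_⟩
  filter_upwards [hAB] with z hz
  constructor <;> linarith [hz.1, hz.2]

/-- Second differences do not see constants, so `M⁺` of the difference is 0. -/
theorem IsUniformlyElliptic.le_sub_const {𝓛 : Set (Rn n → ℝ)} (hI : IsUniformlyElliptic 𝓛 I)
    {ψ : Rn n → ℝ} {x : Rn n} (h : AdmissibleAt ψ x) (c : ℝ) :
    I ψ x ≤ I (fun z => ψ z - c) x := by
  have h1 := (hI _ _ x h (h.sub_const c)).2
  have h2 : (ψ - fun z => ψ z - c) = fun _ => c := by
    funext z; simp
  rw [h2, extremalSup_const] at h1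
  linarith

/-- A solution of the double obstacle problem lies above the subsolutions between the obstacles. -/
theorem subsolution_le_solution (hn : 0 < n) (hs0 : 0 < s) (hs : s < 1)
    (hlam : 0 < lam) (hLam : lam ≤ Lam)
    (hItrans : IsTranslationInvariant I) (hIell : IsUniformlyElliptic (classL0 n s lam Lam) I)
    (hUb : Bornology.IsBounded U)
    (hvb : IsBdd v) (hv : UniformContinuous v) (hvρ : ∀ x, v x ≤ rho K U φ x)
    (hvsub : IsViscositySub (negOp I) U v)
    (hub : IsBdd u) (hu : UniformContinuous u) (huφ : ∀ x, x ∉ U → u x = φ x)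
    (hsuper : IsViscositySuper (doubleObstacleOp I K U φ) U u) (x : Rn n) : v x ≤ u x := by
  have hoff : ∀ x, x ∉ U → v x ≤ u x := fun x hx => by
    rw [huφ x hx, ← rho_of_notMem (K := K) (φ := φ) hx]
    exact hvρ x
  have hmem : ∀ x, u x < v x → x ∈ U := fun x hx => by_contra fun h => (hoff x h).not_gt hx
  refine comparison_principle hn hs0 hs hlam hLam hItrans hIell hv hu hvb hub hUb hoff ?_ ?_ x
  · intro x hx ψ hψb hψc _ htouch
    have : -I ψ x ≤ 0 := hvsub.2 ψ x hψb hψc (hmem x hx) htouch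
    linarith
  · intro x hx ψ hψb hψc _ htouch
    rcases le_max_iff.1 (hsuper.2 ψ x hψb hψc (hmem x hx) htouch) with h | h
    · linarith [(le_min_iff.1 h).1]
    · linarith [hvρ x]

/-- A solution of the double obstacle problem is Lipschitz with respect to the gauge. -/
theorem sub_le_gauge_of_solution (hn : 0 < n) (hs0 : 0 < s) (hs : s < 1)
    (hlam : 0 < lam) (hLam : lam ≤ Lam)
    (hItrans : IsTranslationInvariant I) (hIell : IsUniformlyElliptic (classL0 n s lam Lam) I)
    (hK : Convex ℝ K) (hK0 : K ∈ 𝓝 0) (hU : IsOpen U) (hUb : Bornology.IsBounded U)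
    (hφb : IsBdd φ) (hφ : ∀ x y, φ x - φ y ≤ gauge K (x - y))
    (hub : IsBdd u) (hu : UniformContinuous u) (huφ : ∀ x, x ∉ U → u x = φ x)
    (huρ : ∀ x, u x ≤ rho K U φ x) (hρu : ∀ x, -rhoBar K U φ x ≤ u x)
    (hsub : IsViscositySub (doubleObstacleOp I K U φ) U u)
    (hsuper : IsViscositySuper (doubleObstacleOp I K U φ) U u) (x h : Rn n) :
    u (x + h) ≤ u x + gauge K h := by
  set g := gauge K h with hg
  have hsubst : ∀ x : Rn n, gauge K (x + h - x) = g := fun x => by rw [add_sub_cancel_left]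
  -- If exactly one endpoint is in `U`, the segment crosses `frontier U` at some `y`. The obstacle
  -- bound covers the inner piece, the Lipschitz bound for `φ` the outer one, and the two gauges add
  -- up to `g`.
  have hstep : ∀ x, x ∉ U ∨ x + h ∉ U → u (x + h) ≤ u x + g := by
    intro x hx
    by_cases h1 : x ∈ U
    · have h2 : x + h ∉ U := hx.resolve_left (not_not.2 h1)
      obtain ⟨y, hy, -, hsplit⟩ := exists_frontier_gauge_split K hU h1 h2
      rw [hsubst] at hsplit
      have h3 := rhoBar_le_gauge_sub (K := K) hφb h1 hy
      have h4 := hρu x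
      have h5 := hφ (x + h) y
      rw [huφ _ h2]
      linarith
    · by_cases h2 : x + h ∈ U
      · obtain ⟨y, hy, hsplit, -⟩ := exists_frontier_gauge_split K hU h2 h1
        rw [hsubst] at hsplit
        have h3 := rho_le_gauge_add (K := K) hφb h2 hy
        have h4 := huρ (x + h)
        have h5 := hφ y x
        rw [huφ _ h1]
        linarith
      · have h3 := hφ (x + h) x
        rw [hsubst] at h3
        rw [huφ _ h1, huφ _ h2]
        linarith
  have hmem : ∀ x, u x + g < u (x + h) → x ∈ U ∧ x + h ∈ U := fun x hx => by
    by_contra hc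
    exact (hstep x (not_and_or.1 hc)).not_gt hx
  refine comparison_principle (v := fun x => u (x + h)) (w := fun x => u x + g) hn hs0 hs hlam hLam
    hItrans hIell (hu.comp (uniformContinuous_id.add uniformContinuous_const))
    (hu.add uniformContinuous_const) ?_ ?_ hUb (fun x hx => hstep x (Or.inl hx)) ?_ ?_ x
  · obtain ⟨C, hC⟩ := hub
    exact ⟨C, fun x => hC _⟩
  · obtain ⟨C, hC⟩ := hub
    exact ⟨C + |g|, fun x => (abs_add_le _ _).trans (by linarith [hC x])⟩
  · intro x hx ψ ⟨B, hB⟩ hψc hψa htouch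
    obtain ⟨h1, h2⟩ := hmem x hx
    have h3 := (max_le_iff.1 (hsub.2 (fun y => ψ (y - h)) (x + h) ⟨B, fun x => hB _⟩
      (hψc.comp (contDiff_id.sub contDiff_const)) h2 fun z => by
        have := htouch (z - h)
        simp only [sub_add_cancel] at this
        simpa using this)).1
    have h4 := hItrans ψ h (x + h) (by rwa [add_sub_cancel_right])
    rw [add_sub_cancel_right] at h4
    rw [h4] at h3
    rcases min_le_iff.1 h3 with h5 | h5
    · linarith
    -- Contact with the lower obstacle at `x + h` would give `u (x + h) ≤ -ρ̄ (x + h) ≤ -ρ̄ x + g ≤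
    -- u x + g`.
    · have h6 := rhoBar_le_rhoBar_add hn hK hK0 hUb hφb h1 h2
      rw [hsubst] at h6
      have h7 := hρu x
      linarith
  · intro x hx ψ hψb hψc hψa htouch
    obtain ⟨h1, h2⟩ := hmem x hx
    have h3 := hsuper.2 (fun y => ψ y - g) x (hψa.sub_const g).2.1 (hψc.sub contDiff_const) h1
      fun z => by
        have := htouch z
        linarith
    refine (hIell.le_sub_const hψa g).trans ?_
    rcases le_max_iff.1 h3 with h5 | h5
    · linarith [(le_min_iff.1 h5).1]
    · have h6 := rho_le_rho_add hn hK hK0 hUb hφb h2 h1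
      rw [hsubst] at h6
      have h7 := huρ (x + h)
      linarith

end NonlocalGradient
end

/-! ### The equation with gradient constraint -/

theorem theorem2 (n : ℕ) (hn : 0 < n)
    (s₀ s lam Lam : ℝ) (hs₀ : 0 < s₀) (hs₀s : s₀ < s) (hs : s < 1)
    (hlam : 0 < lam) (hLam : lam ≤ Lam)
    (I : (NonlocalGradient.Rn n → ℝ) → NonlocalGradient.Rn n → ℝ)
    (hI : NonlocalGradient.IsNonlocalOp I)
    (hItrans : NonlocalGradient.IsTranslationInvariant I)
    (hIell : NonlocalGradient.IsUniformlyElliptic (NonlocalGradient.classL0 n s lam Lam) I)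
    (hIzero : ∀ x, I 0 x = 0)
    (K : Set (NonlocalGradient.Rn n)) (hKcomp : IsCompact K) (hKconv : Convex ℝ K)
    (hKint : (0 : NonlocalGradient.Rn n) ∈ interior K)
    (U : Set (NonlocalGradient.Rn n)) (hUopen : IsOpen U) (hUbdd : Bornology.IsBounded U)
    (φ : NonlocalGradient.Rn n → ℝ) (hφbdd : NonlocalGradient.IsBdd φ)
    (hφLip : ∀ x y, -gauge K (y - x) ≤ φ x - φ y ∧ φ x - φ y ≤ gauge K (x - y))
    (hφconv : NonlocalGradient.ConvexNear (frontier U) φ)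
    (v : NonlocalGradient.Rn n → ℝ) (hvbdd : NonlocalGradient.IsBdd v) (hvcont : Continuous v)
    (hvobst : ∀ x, -NonlocalGradient.rhoBar K U φ x ≤ v x ∧ v x ≤ NonlocalGradient.rho K U φ x)
    (hvsub : NonlocalGradient.IsViscositySub (NonlocalGradient.negOp I) U v)
    (u : NonlocalGradient.Rn n → ℝ) (huC1 : ContDiffOn ℝ 1 u U)
    (hu : NonlocalGradient.SolvesDirichlet
      (NonlocalGradient.doubleObstacleOp I K U φ) U φ u) :
    NonlocalGradient.SolvesDirichlet (NonlocalGradient.gradConstraintOp I K) U φ u := by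
  open NonlocalGradient in
  obtain ⟨⟨hucont, husub, husuper⟩, huφ⟩ := hu
  have hs0 : 0 < s := hs₀.trans hs₀s
  have hK0 : K ∈ 𝓝 0 := mem_interior_iff_mem_nhds.1 hKint
  have hφuc := uniformContinuous_of_gauge_bound hK0 hφLip
  have hub := isBdd_of_eq_off_bounded hucont hφbdd hUbdd huφ
  have huuc := uniformContinuous_of_eq_off_bounded hucont hφuc hUbdd huφ
  have hvφ : ∀ x, x ∉ U → v x = φ x := fun x hx => by
    have := hvobst x
    rw [rhoBar_of_notMem hx, rho_of_notMem hx, neg_neg] at this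
    exact le_antisymm this.2 this.1
  have hvuc := uniformContinuous_of_eq_off_bounded hvcont hφuc hUbdd hvφ
  have huρ := le_rho_of_sub hn hKconv hK0 hUopen hUbdd hφbdd hucont hub huφ husub
  have hρu := neg_rhoBar_le_of_super hn hKconv hK0 hUopen hUbdd hφbdd
    (fun x => (hvobst x).1.trans (hvobst x).2) hucont hub huφ husuper
  have hvu := subsolution_le_solution hn hs0 hs hlam hLam hItrans hIell hUbdd hvbdd hvuc
    (fun x => (hvobst x).2) hvsub hub huuc huφ husuper
  have hLip := sub_le_gauge_of_solution hn hs0 hs hlam hLam hItrans hIell hKconv hK0 hUopen hUbdd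
    hφbdd (fun x y => (hφLip x y).2) hub huuc huφ huρ hρu husub husuper
  refine ⟨⟨hucont, ⟨hucont.upperSemicontinuous, ?_⟩, hucont.lowerSemicontinuous, ?_⟩, huφ⟩
  · intro ψ x₀ hψb hψc hx₀ htouch
    refine max_le ?_ ?_
    · rcases min_le_iff.1 (max_le_iff.1 (husub.2 ψ x₀ hψb hψc hx₀ htouch)).1 with h | h
      · exact h
      -- Here `u x₀ ≤ -ρ̄ x₀ ≤ v x₀`, and `v ≤ u` everywhere, so `v - ψ` is also maximal at `x₀`.
      · refine hvsub.2 ψ x₀ hψb hψc hx₀ fun x => ?_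
        have h1 := htouch x
        have h2 := hvu x
        have h3 := (hvobst x₀).1
        linarith
    · rw [sub_nonpos]
      refine gauge_le_one_of_mem fun y hy => ?_
      have h1 : ∀ t ∈ Ioc (0 : ℝ) 1, -ψ (x₀ + t • (-y)) - -ψ x₀ ≤ t * 1 := by
        intro t ht
        have h2 := htouch (x₀ + t • (-y))
        have h3 := hLip (x₀ + t • (-y)) (t • y)
        rw [show x₀ + t • (-y) + t • y = x₀ by simp, gauge_smul_of_nonneg ht.1.le,
          smul_eq_mul] at h3
        have h4 : t * gauge K y ≤ t * 1 :=
          mul_le_mul_of_nonneg_left (gauge_le_one_of_mem hy) ht.1.le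
        linarith
      have h5 := inner_gradient_le hψc.neg h1
      have h6 : gradient (fun x => -ψ x) x₀ = -gradient ψ x₀ := by
        simp [gradient]
      rwa [h6, inner_neg_neg] at h5
  · intro ψ x₀ hψb hψc hx₀ htouch
    rcases le_max_iff.1 (husuper.2 ψ x₀ hψb hψc hx₀ htouch) with h | h
    · exact le_max_of_le_left (le_min_iff.1 h).1
    · refine le_max_of_le_right (sub_nonneg.2 ?_)
      obtain ⟨y, hy, hρy⟩ := exists_rho_eq hn hKconv hK0 hUbdd hφuc.continuous hx₀
      have hyU : y ∉ U := fun hyU => by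
        have : y ∈ U ∩ frontier U := ⟨hyU, hy⟩
        rw [hUopen.inter_frontier_eq] at this
        exact this
      refine one_le_gauge_polarSet (z := x₀ - y) hKcomp.isBounded hK0
        (sub_ne_zero.2 fun h => hyU (h ▸ hx₀)) ?_
      -- Toward the minimizer `y`, the Lipschitz bound from `y` and `u x₀ ≥ ρ x₀` make `u` fall by
      -- at least `t * gauge K (x₀ - y)`; `ψ`, touching from below, falls at least as fast.
      have h1 : inner ℝ (gradient ψ x₀) (y - x₀) ≤ -gauge K (x₀ - y) := by
        refine inner_gradient_le hψc fun t ht => ?_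
        have h2 := htouch (x₀ + t • (y - x₀))
        have h3 := hLip y ((1 - t) • (x₀ - y))
        rw [show y + (1 - t) • (x₀ - y) = x₀ + t • (y - x₀) by module,
          gauge_smul_of_nonneg (sub_nonneg.2 ht.2), smul_eq_mul, huφ y hyU] at h3
        linarith
      rw [← neg_sub y x₀, inner_neg_right, neg_sub]
      linarith
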